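/- Let $(E,\mathcal E)$ be a Borel space (a standard Borel measurable space), let $\alpha$ be a finite measure on $E$ and let $p\in(0,1)$. Let $\mathbf N_{<\infty}$ be the space of finite counting measures on $E$, that is, finite measures $\eta$ with $\eta(B)\in\mathbb N_0$ for all $B\in\mathcal E$, equipped with the $\sigma$-algebra generated by the maps $\eta\mapsto\eta(B)$, $B\in\mathcal E$. Write $(a)^{(k)}=a(a+1)\cdots(a+k-1)$ and $(x)_k=x(x-1)\cdots(x-k+1)$, with $(a)^{(0)}=(x)_0=1$. Let $\rho$ be the Pascal distribution with parameters $\alpha$ and $p$, i.e. the probability measure on $\mathbf N_{<\infty}$ under which $\eta(B_1),\dots,\eta(B_m)$ are independent whenever $B_1,\dots,B_m\in\mathcal E$ are pairwise disjoint, and $$\rho(\eta(B)=k)=(1-p)^{\alpha(B)}\,(\alpha(B))^{(k)}\,\frac{p^k}{k!},\qquad B\in\mathcal E,\ k\in\mathbb N_0 .$$ For $n\in\mathbb N_0$ let $\mathcal P_{n-1}\subset L^2(\rho)$ be the space of linear combinations of the maps $\eta\mapsto\int f\,\mathrm d\eta^{\otimes k}$ with $0\le k\le n-1$ and $f:E^k\to\mathbb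 R$ bounded and measurable (for $k=0$ these are the constants; $\mathcal P_{-1}=\{0\}$). For bounded measurable $f:E^n\to\mathbb R$ let $I_n(f,\cdot)$ be the orthogonal projection in $L^2(\rho)$ of $\eta\mapsto\int f\,\mathrm d\eta^{\otimes n}$ onto $\overline{\mathcal P_{n-1}}^{\perp}$. For $n\in\mathbb N_0$ and $a\ge 0$ let $$\mathscr M_n(x;a;p)=\sum_{k=0}^n\binom nk\Bigl(1-\frac1p\Bigr)^{k-n}(a+k)^{(n-k)}(x)_k$$ be the monic Meixner polynomials. Then for all $N\in\mathbb N$, all pairwise disjoint $B_1,\dots,B_N\in\mathcal E$ and all $d_1,\dots,d_N\in\mathbb N_0$, with $n=d_1+\dots+d_N$, the map $\eta\mapsto\int \mathbf 1_{B_1}^{\otimes d_1}\otimes\cdots\otimes\mathbf 1_{B_N}^{\otimes d_N}\,\mathrm d\eta^{\otimes n}$ belongs to $L^2(\rho)$ and $$I_n\bigl(\mathbf 1_{B_1}^{\otimes d_1}\otimes\cdots\otimes\mathbf 1_{B_N}^{\otimes d_N},\eta\bigr)=\prod_{k=1}^N\mathscr M_{d_k}\bigl(\eta(B_k);\alpha(B_k);p\bigr)\qquad\text{for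 }\rho\text{-almost every }\eta .$$ -/

import Mathlib

open MeasureTheory ProbabilityTheory

noncomputable section

namespace PascalMeixner

/-- The space of finite counting measures on `E`: finite measures with values in `ℕ` on every
measurable set. -/
structure Conf (E : Type*) [MeasurableSpace E] where
  meas : Measure E
  isFinite : IsFiniteMeasure meas
  isCount : ∀ B, MeasurableSet B → ∃ k : ℕ, meas B = k

variable {E : Type*} [MeasurableSpace E]

/-- The σ-algebra generated by the counting variables `η ↦ η B`, `B` measurable. -/
instance : MeasurableSpace (Conf E) :=
  ⨆ (B : Set E) (_ : MeasurableSet B),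
    MeasurableSpace.comap (fun η : Conf E => η.meas B) inferInstance

instance (η : Conf E) : IsFiniteMeasure η.meas := η.isFinite

/-- The mass that the negative binomial law with parameters `a` and `p` gives to `k`. -/
def negBinomial (a p : ℝ) (k : ℕ) : ℝ :=
  (ascPochhammer ℝ k).eval a * (p ^ k / (k.factorial : ℝ)) * (1 - p) ^ a

/-- `ρ` is the Pascal distribution with parameters `α` and `p`: under `ρ`, counts in disjoint
regions are independent and the count in each region is negative binomial. -/
structure IsPascal (α : Measure E) (p : ℝ) (ρ : Measure (Conf E)) : Prop where
  indep : ∀ (m : ℕ) (B : Fin m → Set E), (∀ i, MeasurableSet (B i)) →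
    Pairwise (Function.onFun Disjoint B) → iIndepFun (fun i (η : Conf E) => η.meas (B i)) ρ
  law : ∀ B : Set E, MeasurableSet B → ∀ k : ℕ,
    ρ {η : Conf E | η.meas B = k} = ENNReal.ofReal (negBinomial (α.real B) p k)

/-- The monomial `η ↦ ∫ f dη^{⊗n}`; for `n = 0` it is the constant given by the only value
of `f`. -/
def monomial {n : ℕ} (f : (Fin n → E) → ℝ) (η : Conf E) : ℝ :=
  ∫ x, f x ∂(Measure.pi fun _ : Fin n => η.meas)

variable (E) in
/-- Generalized polynomials of degree strictly less than `n`: linear combinations of monomials of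
degree `k < n` with bounded measurable coefficients (only `0` if `n = 0`). -/
def polyDegLT (n : ℕ) : Submodule ℝ (Conf E → ℝ) :=
  Submodule.span ℝ {q | ∃ k < n, ∃ f : (Fin k → E) → ℝ,
    Measurable f ∧ (∃ C : ℝ, ∀ x, |f x| ≤ C) ∧ q = monomial f}

/-- Generalized polynomials of degree strictly less than `n` as a subspace of `L²(ρ)`. -/
def polyL2 (ρ : Measure (Conf E)) (n : ℕ) : Submodule ℝ (Lp ℝ 2 ρ) where
  carrier := {F | ∃ q ∈ polyDegLT E n, F =ᵐ[ρ] q}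
  zero_mem' := ⟨0, Submodule.zero_mem _, Lp.coeFn_zero ℝ 2 ρ⟩
  add_mem' := by
    rintro F G ⟨q, hq, hFq⟩ ⟨r, hr, hGr⟩
    exact ⟨q + r, Submodule.add_mem _ hq hr, (Lp.coeFn_add F G).trans (hFq.add hGr)⟩
  smul_mem' := by
    rintro c F ⟨q, hq, hFq⟩
    exact ⟨c • q, Submodule.smul_mem _ c hq, (Lp.coeFn_smul c F).trans (hFq.const_smul c)⟩

/-- The generalized orthogonal polynomial `I_n(f)`: the orthogonal projection in `L²(ρ)` of the
monomial `η ↦ η^{⊗n}(f)` onto the orthogonal complement of the closure of the space of generalized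
polynomials of degree at most `n - 1`. -/
def genOrthPoly (ρ : Measure (Conf E)) {n : ℕ} (f : (Fin n → E) → ℝ)
    (hf : MemLp (monomial f) 2 ρ) : Lp ℝ 2 ρ :=
  ((polyL2 ρ n).topologicalClosure)ᗮ.starProjection (hf.toLp (monomial f))

/-- The monic Meixner polynomial of degree `n` with parameters `a`, `p`, evaluated at `x`. -/
def meixner (n : ℕ) (x a p : ℝ) : ℝ :=
  ∑ k ∈ Finset.range (n + 1), (n.choose k : ℝ) * (1 - 1 / p) ^ ((k : ℤ) - (n : ℤ)) *
    (ascPochhammer ℝ (n - k)).eval (a + k) * (descPochhammer ℝ k).eval x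

/-- The function `1_{B_1}^{⊗d_1} ⊗ ⋯ ⊗ 1_{B_N}^{⊗d_N}` on `E^(d_1 + ⋯ + d_N)`; the coordinates are
grouped into consecutive blocks of lengths `d_1, …, d_N`. -/
def tensorIndicator {N : ℕ} (B : Fin N → Set E) (d : Fin N → ℕ) (x : Fin (∑ k, d k) → E) : ℝ :=
  ∏ k, ∏ j : Fin (d k), (B k).indicator (fun _ => (1 : ℝ)) (x (finSigmaFinEquiv ⟨k, j⟩))

end PascalMeixner

end

noncomputable section

namespace PascalMeixner

/-! ### Rising factorials and negative binomial series -/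

/-! Write Φ for the product of Meixner polynomials. It is the required projection once two facts
hold: Φ is orthogonal to every generalized polynomial of degree less than n, and the monomial minus
Φ is such a polynomial. The second fact holds because Meixner polynomials are monic
(`monomial_sub_prod_meixner_mem_polyDegLT`).

For the first, comparing two finite measures on a π-system reduces general coefficients to
indicators of boxes A_1 × ⋯ × A_k with k < n (`integral_mul_monomial_eq_zero`). Cut the B_i and A_j
into disjoint atoms. The generating series (1 - qX)^(-a) (1 + X/(1 - qX))^x, with q = (1 - 1/p)⁻¹,
is multiplicative in (a, x), so each Meixner polynomial in η(B_i) expands into products of Meixner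
polynomials in the atom counts, of the same total degree (`meixner_sum`). Each η(A_j) is a sum of
atom counts. By independence every term of the expanded integral factorizes over the atoms. As k <
n, some atom carries a power of its count smaller than the degree of its Meixner polynomial, and
this factor vanishes by one-dimensional orthogonality (`hasSum_negBinomial_mul_pow_mul_meixner`). -/

lemma ascPochhammer_eval_add (a : ℝ) (m n : ℕ) :
    (ascPochhammer ℝ (m + n)).eval a =
      (ascPochhammer ℝ m).eval a * (ascPochhammer ℝ n).eval (a + m) := by
  rw [← ascPochhammer_mul]
  simp

lemma ascPochhammer_eval_nonneg {a : ℝ} (ha : 0 ≤ a) (n : ℕ) :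
    0 ≤ (ascPochhammer ℝ n).eval a := by
  induction n with
  | zero => simp
  | succ n ih => rw [ascPochhammer_succ_eval]; positivity

lemma pow_le_ascPochhammer_eval {x y : ℝ} (hx : 0 ≤ x) (hxy : x ≤ y) (n : ℕ) :
    x ^ n ≤ (ascPochhammer ℝ n).eval y := by
  induction n with
  | zero => simp
  | succ n ih =>
    rw [ascPochhammer_succ_eval, pow_succ]
    have : (0 : ℝ) ≤ n := n.cast_nonneg
    exact mul_le_mul ih (by linarith) hx ((pow_nonneg hx n).trans ih)

lemma multichoose_eq_ascPochhammer_div (s : ℝ) (n : ℕ) :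
    Ring.multichoose s n = (ascPochhammer ℝ n).eval s / n.factorial := by
  rw [eq_div_iff (by positivity), ← Polynomial.ascPochhammer_smeval_eq_eval,
    ← Ring.factorial_nsmul_multichoose_eq_ascPochhammer, nsmul_eq_mul, mul_comm]

/-- The negative binomial series. -/
lemma hasSum_ascPochhammer_mul_pow_div (s : ℝ) {p : ℝ} (hp0 : 0 < p) (hp1 : p < 1) :
    HasSum (fun n : ℕ => (ascPochhammer ℝ n).eval s * (p ^ n / n.factorial))
      ((1 - p) ^ (-s)) := by
  have h := (Real.one_div_one_sub_rpow_hasFPowerSeriesOnBall_zero s).hasSum (y := p)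
    (by simpa [enorm_eq_nnnorm, ← NNReal.coe_lt_coe, abs_of_pos hp0] using hp1)
  rw [zero_add, one_div, ← Real.rpow_neg (by linarith)] at h
  convert! h using 2 with n
  rw [FormalMultilinearSeries.ofScalars_apply_eq, ← Ring.multichoose_eq,
    multichoose_eq_ascPochhammer_div, smul_eq_mul]
  ring

/-! ### Generating series of the Meixner polynomials -/

/-- The formal power series of `(1 - q X) ^ (-a)`. -/
def risingSeries (q a : ℝ) : PowerSeries ℝ :=
  PowerSeries.mk fun n => q ^ n * ((ascPochhammer ℝ n).eval a / n.factorial)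

/-- Via the binomial series, additivity in the exponent becomes multiplicativity of `risingSeries`
in `a`. -/
lemma risingSeries_eq_rescale (q a : ℝ) :
    risingSeries q a = PowerSeries.rescale (-q) (PowerSeries.binomialSeries ℝ (-a)) := by
  ext n
  have h : (ascPochhammer ℝ n).eval a / n.factorial = (-1) ^ n * Ring.choose (-a) n := by
    rw [← multichoose_eq_ascPochhammer_div, Ring.choose_neg, Ring.multichoose_eq]
    rw [Units.smul_def, zsmul_eq_mul]
    simp [← mul_assoc, ← mul_pow]
  rw [risingSeries, PowerSeries.coeff_mk, PowerSeries.coeff_rescale,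
    PowerSeries.binomialSeries_coeff, h, smul_eq_mul, mul_one, ← mul_assoc, ← mul_pow, mul_neg_one]

lemma risingSeries_add (q a b : ℝ) :
    risingSeries q (a + b) = risingSeries q a * risingSeries q b := by
  simp only [risingSeries_eq_rescale, neg_add, PowerSeries.binomialSeries_add, map_mul]

lemma risingSeries_zero (q : ℝ) : risingSeries q 0 = 1 := by
  simp [risingSeries_eq_rescale]

lemma risingSeries_sum {ι : Type*} (s : Finset ι) (q : ℝ) (a : ι → ℝ) :
    risingSeries q (∑ i ∈ s, a i) = ∏ i ∈ s, risingSeries q (a i) := by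
  classical
  induction s using Finset.induction_on with
  | empty => simp [risingSeries_zero]
  | insert i s hi ih => rw [Finset.sum_insert hi, Finset.prod_insert hi, risingSeries_add, ih]

lemma risingSeries_add_natCast (q a : ℝ) (k : ℕ) :
    risingSeries q (a + k) = risingSeries q a * risingSeries q 1 ^ k := by
  induction k with
  | zero => simp
  | succ k ih => rw [Nat.cast_succ, ← add_assoc, risingSeries_add, ih, pow_succ, mul_assoc]

/-- The exponential generating series of the Meixner polynomials at the integer point `x`. -/
def meixnerSeries (q a : ℝ) (x : ℕ) : PowerSeries ℝ :=
  risingSeries q a * (1 + PowerSeries.X * risingSeries q 1) ^ x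

/-- Both factors of the series are exponential, one in `a` and the other in `x`; comparing
coefficients yields the addition theorem. -/
lemma meixnerSeries_sum {ι : Type*} (s : Finset ι) (q : ℝ) (a : ι → ℝ) (x : ι → ℕ) :
    meixnerSeries q (∑ i ∈ s, a i) (∑ i ∈ s, x i) = ∏ i ∈ s, meixnerSeries q (a i) (x i) := by
  simp only [meixnerSeries, risingSeries_sum, Finset.prod_mul_distrib, Finset.prod_pow_eq_pow_sum]

lemma meixner_eq_sum_pow (n : ℕ) (x a p : ℝ) :
    meixner n x a p = ∑ k ∈ Finset.range (n + 1), (n.choose k : ℝ) * (1 - 1 / p)⁻¹ ^ (n - k) *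
      (ascPochhammer ℝ (n - k)).eval (a + k) * (descPochhammer ℝ k).eval x := by
  refine Finset.sum_congr rfl fun k hk => ?_
  have hk' : k ≤ n := Nat.lt_succ_iff.1 (Finset.mem_range.1 hk)
  rw [show (k : ℤ) - n = -((n - k : ℕ) : ℤ) by push_cast [hk']; ring, zpow_neg, zpow_natCast,
    inv_pow]

/-- Expanding the `x`-th power binomially, the `k`-th term is `x.choose k` times X^k (1 - qX)^(-(a +
k)), which contributes exactly the `k`-th summand of the Meixner polynomial. -/
lemma coeff_meixnerSeries (n : ℕ) (a p : ℝ) (x : ℕ) :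
    PowerSeries.coeff n (meixnerSeries (1 - 1 / p)⁻¹ a x) =
      meixner n x a p / n.factorial := by
  set q := (1 - 1 / p)⁻¹
  have hterm : ∀ k, PowerSeries.coeff n (risingSeries q a *
      ((PowerSeries.X * risingSeries q 1) ^ k * (x.choose k : PowerSeries ℝ))) =
      if k ≤ n then (n.choose k : ℝ) * q ^ (n - k) * (ascPochhammer ℝ (n - k)).eval (a + k) *
        (descPochhammer ℝ k).eval (x : ℝ) / n.factorial else 0 := by
    intro k
    have h : risingSeries q a *
        ((PowerSeries.X * risingSeries q 1) ^ k * (x.choose k : PowerSeries ℝ)) =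
        PowerSeries.C (x.choose k : ℝ) * (PowerSeries.X ^ k * risingSeries q (a + k)) := by
      rw [risingSeries_add_natCast, mul_pow, map_natCast]
      ring
    rw [h, PowerSeries.coeff_C_mul, PowerSeries.coeff_X_pow_mul']
    split_ifs with hk
    · rw [risingSeries, PowerSeries.coeff_mk, Nat.cast_choose_eq_descPochhammer_div ℝ x k,
        Nat.cast_choose ℝ hk]
      field_simp
    · simp
  rw [meixnerSeries, add_comm, add_pow, Finset.mul_sum, map_sum, meixner_eq_sum_pow,
    Finset.sum_div]
  simp only [one_pow, mul_one, hterm]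
  -- The binomial theorem sums up to `x` and the Meixner polynomial up to `n`. Both ranges are
  -- extended to `max x n`: the falling factorial vanishes for `k > x`, the condition `k ≤ n` fails
  -- for `k > n`.
  have hl := Finset.sum_subset (f := fun k => if k ≤ n then
      (n.choose k : ℝ) * q ^ (n - k) * (ascPochhammer ℝ (n - k)).eval (a + k) *
        (descPochhammer ℝ k).eval (x : ℝ) / n.factorial else 0)
    (Finset.range_mono (Nat.add_le_add_right (le_max_left x n) 1)) (by
      intro k _ hk
      have hxk : x < k := by simpa using hk
      simp [descPochhammer_eval_coe_nat_of_lt hxk])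
  have hr := Finset.sum_subset (f := fun k => if k ≤ n then
      (n.choose k : ℝ) * q ^ (n - k) * (ascPochhammer ℝ (n - k)).eval (a + k) *
        (descPochhammer ℝ k).eval (x : ℝ) / n.factorial else 0)
    (Finset.range_mono (Nat.add_le_add_right (le_max_right x n) 1)) (by
      intro k _ hk
      have hxk : n < k := by simpa using hk
      rw [if_neg (by omega)])
  rw [hl, ← hr]
  exact Finset.sum_congr rfl fun k hk =>
    if_pos (Nat.lt_succ_iff.1 (Finset.mem_range.1 hk))

/-- The addition theorem for Meixner polynomials. -/
lemma meixner_sum {ι : Type*} [DecidableEq ι] (s : Finset ι) (n : ℕ) (p : ℝ) (a : ι → ℝ)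
    (x : ι → ℕ) :
    meixner n ((∑ i ∈ s, x i : ℕ) : ℝ) (∑ i ∈ s, a i) p = n.factorial *
      ∑ l ∈ s.finsuppAntidiag n, ∏ i ∈ s, (meixner (l i) (x i) (a i) p / (l i).factorial) := by
  have h := coeff_meixnerSeries n (∑ i ∈ s, a i) p (∑ i ∈ s, x i)
  rw [meixnerSeries_sum, PowerSeries.coeff_prod] at h
  simp only [coeff_meixnerSeries] at h
  rw [h]
  field_simp

/-! ### Orthogonality in one dimension -/

lemma negBinomial_nonneg {a p : ℝ} (ha : 0 ≤ a) (hp0 : 0 < p) (hp1 : p < 1) (k : ℕ) :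
    0 ≤ negBinomial a p k := by
  have := ascPochhammer_eval_nonneg ha k
  have : 0 ≤ (1 - p) ^ a := Real.rpow_nonneg (by linarith) _
  unfold negBinomial
  positivity

/-- Mixed factorial moments of the negative binomial distribution. -/
lemma hasSum_negBinomial_mul_desc_mul_asc (a : ℝ) {p : ℝ} (hp0 : 0 < p) (hp1 : p < 1) (k f : ℕ) :
    HasSum (fun x : ℕ => negBinomial a p x *
        ((descPochhammer ℝ k).eval (x : ℝ) * (ascPochhammer ℝ f).eval (a + x)))
      ((p / (1 - p)) ^ k * (ascPochhammer ℝ (k + f)).eval a * (1 - p)⁻¹ ^ f) := by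
  have hp : 0 < 1 - p := by linarith
  -- The terms with `x < k` vanish; after the shift by `k`, what remains is a multiple of the
  -- negative binomial series with parameter `a + k + f`.
  rw [← hasSum_nat_add_iff' k]
  rw [Finset.sum_eq_zero, sub_zero]
  · have h := (hasSum_ascPochhammer_mul_pow_div (a + (k + f : ℕ)) hp0 hp1).mul_left
      (p ^ k * (ascPochhammer ℝ (k + f)).eval a * (1 - p) ^ a)
    convert! h using 1
    · ext y
      -- Both sides are the rising factorial of `a` of length `y + k + f`, split at different
      -- places.
      have h1 : (ascPochhammer ℝ (y + k)).eval a * (ascPochhammer ℝ f).eval (a + (y + k : ℕ)) =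
          (ascPochhammer ℝ (k + f)).eval a * (ascPochhammer ℝ y).eval (a + (k + f : ℕ)) := by
        rw [← ascPochhammer_eval_add, ← ascPochhammer_eval_add]
        congr 2
        omega
      have h2 : (descPochhammer ℝ k).eval ((y + k : ℕ) : ℝ) = (y + k).factorial / y.factorial := by
        rw [descPochhammer_eval_eq_descFactorial,
          eq_div_iff (by positivity), mul_comm, ← Nat.cast_mul]
        have := Nat.factorial_mul_descFactorial (Nat.le_add_left k y)
        rw [Nat.add_sub_cancel] at this
        rw [this]
      rw [negBinomial, h2]
      calc _ = ((ascPochhammer ℝ (y + k)).eval a * (ascPochhammer ℝ f).eval (a + (y + k : ℕ))) *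
            (p ^ (y + k) / y.factorial) * (1 - p) ^ a := by field_simp
        _ = _ := by rw [h1, pow_add]; ring
    · rw [neg_add, Real.rpow_add hp, Real.rpow_neg hp.le, Real.rpow_neg hp.le, Real.rpow_natCast,
        pow_add, div_pow, inv_pow]
      have := Real.rpow_pos_of_pos hp a
      field_simp
  · intro x hx
    rw [descPochhammer_eval_coe_nat_of_lt (Finset.mem_range.1 hx)]
    simp

lemma hasSum_negBinomial_mul_meixner_mul_asc (a : ℝ) {p : ℝ} (hp0 : 0 < p) (hp1 : p < 1)
    {n f : ℕ} (hf : f < n) :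
    HasSum (fun x : ℕ => negBinomial a p x *
        (meixner n x a p * (ascPochhammer ℝ f).eval (a + x))) 0 := by
  have hp : 0 < 1 - p := by linarith
  have hq : (1 - 1 / p)⁻¹ = -(p / (1 - p)) := by
    rw [show 1 - 1 / p = -((1 - p) / p) by field_simp; ring, inv_neg, inv_div]
  have h := hasSum_sum (s := Finset.range (n + 1)) fun k _ =>
    (hasSum_negBinomial_mul_desc_mul_asc a hp0 hp1 k f).mul_left
      ((n.choose k : ℝ) * (1 - 1 / p)⁻¹ ^ (n - k) * (ascPochhammer ℝ (n - k)).eval (a + k))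
  convert! h using 1
  · ext x
    rw [meixner_eq_sum_pow, Finset.sum_mul, Finset.mul_sum]
    exact Finset.sum_congr rfl fun k _ => by ring
  -- Up to a common factor the sum of moments is the `n`-th forward difference of a polynomial of
  -- degree `f < n`. The alternating sign comes from `(1 - 1 / p)⁻¹` being negative.
  · have hdiff := congrFun (Polynomial.fwdDiff_iter_eq_zero_of_degree_lt
      (P := ascPochhammer ℝ f) (n := n) (by rwa [ascPochhammer_natDegree])) a
    rw [fwdDiff_iter_eq_sum_shift] at hdiff
    have hterm : ∀ k ∈ Finset.range (n + 1),
        ((n.choose k : ℝ) * (1 - 1 / p)⁻¹ ^ (n - k) * (ascPochhammer ℝ (n - k)).eval (a + k)) *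
          ((p / (1 - p)) ^ k * (ascPochhammer ℝ (k + f)).eval a * (1 - p)⁻¹ ^ f) =
        ((p / (1 - p)) ^ n * (ascPochhammer ℝ n).eval a * (1 - p)⁻¹ ^ f) *
          (((-1 : ℤ) ^ (n - k) * n.choose k) • (ascPochhammer ℝ f).eval (a + k • (1 : ℝ))) := by
      intro k hk
      have hk' : k ≤ n := Nat.lt_succ_iff.1 (Finset.mem_range.1 hk)
      obtain ⟨m, rfl⟩ := Nat.exists_eq_add_of_le hk'
      rw [hq, neg_pow, ascPochhammer_eval_add a k f, Nat.add_sub_cancel_left,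
        ascPochhammer_eval_add a k m, zsmul_eq_mul, nsmul_eq_mul, mul_one,
        pow_add]
      push_cast
      ring
    rw [Finset.sum_congr rfl hterm, ← Finset.mul_sum, hdiff]
    simp

/-- Meixner polynomials are orthogonal to powers of lower degree under the negative binomial
distribution. -/
lemma hasSum_negBinomial_mul_pow_mul_meixner (a : ℝ) {p : ℝ} (hp0 : 0 < p) (hp1 : p < 1)
    {n j : ℕ} (hj : j < n) :
    HasSum (fun x : ℕ => negBinomial a p x * ((x : ℝ) ^ j * meixner n x a p)) 0 := by
  -- Carrying a rising factorial along lets the induction trade a factor x for (a + x + f) - (a +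
  -- f), whose first term lengthens the rising factorial by one.
  suffices h : ∀ j f : ℕ, f + j < n → HasSum (fun x : ℕ => negBinomial a p x *
      ((x : ℝ) ^ j * (meixner n x a p * (ascPochhammer ℝ f).eval (a + x)))) 0 by
    simpa using h j 0 (by omega)
  intro j
  induction j with
  | zero => intro f hf; simpa using hasSum_negBinomial_mul_meixner_mul_asc a hp0 hp1 (by omega)
  | succ j ih =>
    intro f hf
    have h := (ih (f + 1) (by omega)).sub ((ih f (by omega)).mul_left (a + f))
    rw [mul_zero, sub_zero] at h
    convert! h using 2 with x
    rw [ascPochhammer_succ_eval]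
    ring

lemma summable_negBinomial_mul_pow {a p : ℝ} (ha : 0 ≤ a) (hp0 : 0 < p) (hp1 : p < 1) (m : ℕ) :
    Summable fun x : ℕ => negBinomial a p x * (x : ℝ) ^ m := by
  have h := (hasSum_negBinomial_mul_desc_mul_asc a hp0 hp1 0 m).summable
  refine h.of_nonneg_of_le
    (fun x => mul_nonneg (negBinomial_nonneg ha hp0 hp1 x) (by positivity)) fun x => ?_
  refine mul_le_mul_of_nonneg_left ?_ (negBinomial_nonneg ha hp0 hp1 x)
  simpa using pow_le_ascPochhammer_eval x.cast_nonneg (le_add_of_nonneg_left ha) m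

/-- The Meixner polynomial of degree `n` is monic of degree `n`. -/
lemma exists_meixner_coeff (n : ℕ) (a p : ℝ) :
    ∃ c : ℕ → ℝ, c n = 1 ∧
      ∀ x : ℝ, meixner n x a p = ∑ j ∈ Finset.range (n + 1), c j * x ^ j := by
  let c : ℕ → ℝ := fun k => (n.choose k : ℝ) * (1 - 1 / p)⁻¹ ^ (n - k) *
    (ascPochhammer ℝ (n - k)).eval (a + k)
  let P : Polynomial ℝ := ∑ k ∈ Finset.range (n + 1), Polynomial.C (c k) * descPochhammer ℝ k
  have hdeg : ∀ k, (descPochhammer ℝ k).natDegree = k := fun k => descPochhammer_natDegree ℝ k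
  have hP : P.natDegree ≤ n := Polynomial.natDegree_sum_le_of_forall_le _ _ fun k hk =>
    (Polynomial.natDegree_C_mul_le _ _).trans
      (by rw [hdeg]; exact Nat.lt_succ_iff.1 (Finset.mem_range.1 hk))
  refine ⟨P.coeff, ?_, fun x => ?_⟩
  · rw [Polynomial.finsetSum_coeff, Finset.sum_range_succ, Finset.sum_eq_zero]
    · have h := (monic_descPochhammer ℝ n).coeff_natDegree
      rw [hdeg] at h
      simp [c, h]
    · intro k hk
      rw [Polynomial.coeff_C_mul, Polynomial.coeff_eq_zero_of_natDegree_lt, mul_zero]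
      rw [hdeg]
      exact Finset.mem_range.1 hk
  · rw [← Polynomial.eval_eq_sum_range' (Nat.lt_succ_iff.2 hP), meixner_eq_sum_pow,
      Polynomial.eval_finsetSum]
    exact Finset.sum_congr rfl fun k _ => by simp [c]

lemma measurable_meixner (n : ℕ) (a p : ℝ) : Measurable fun x => meixner n x a p := by
  obtain ⟨c, -, hc⟩ := exists_meixner_coeff n a p
  simp only [hc]
  fun_prop

section

variable {E : Type*} [MeasurableSpace E]

/-! ### Counting variables -/

lemma measurable_meas {B : Set E} (hB : MeasurableSet B) :
    Measurable fun η : Conf E => η.meas B :=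
  Measurable.mono (comap_measurable _) (le_iSup₂_of_le B hB le_rfl) le_rfl

lemma measurable_real {B : Set E} (hB : MeasurableSet B) :
    Measurable fun η : Conf E => η.meas.real B :=
  (measurable_meas hB).ennreal_toReal

/-- The number of points of `η` in `B`. -/
def count (B : Set E) (η : Conf E) : ℕ := ⌊η.meas.real B⌋₊

lemma natCast_count {B : Set E} (hB : MeasurableSet B) (η : Conf E) :
    (count B η : ℝ) = η.meas.real B := by
  obtain ⟨k, hk⟩ := η.isCount B hB
  simp [count, measureReal_def, hk]

lemma measurable_count {B : Set E} (hB : MeasurableSet B) :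
    Measurable fun η : Conf E => count B η :=
  Nat.measurable_floor.comp (measurable_real hB)

section Law

variable {α : Measure E} {p : ℝ} {ρ : Measure (Conf E)}

lemma IsPascal.map_count_singleton (hρ : IsPascal α p ρ) {B : Set E} (hB : MeasurableSet B)
    (k : ℕ) : ρ.map (count B) {k} = ENNReal.ofReal (negBinomial (α.real B) p k) := by
  rw [Measure.map_apply (measurable_count hB) (measurableSet_singleton k), ← hρ.law B hB k]
  congr 1
  ext η
  obtain ⟨m, hm⟩ := η.isCount B hB
  simp [count, measureReal_def, hm]

lemma IsPascal.map_count (hρ : IsPascal α p ρ) {B : Set E} (hB : MeasurableSet B) :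
    ρ.map (count B) = Measure.sum fun k : ℕ =>
      ENNReal.ofReal (negBinomial (α.real B) p k) • Measure.dirac k := by
  rw [← Measure.sum_smul_dirac (ρ.map (count B))]
  simp only [hρ.map_count_singleton hB]

lemma IsPascal.integrable_comp (hρ : IsPascal α p ρ) (hp0 : 0 < p) (hp1 : p < 1) {B : Set E}
    (hB : MeasurableSet B) {g : ℝ → ℝ}
    (hs : Summable fun k : ℕ => negBinomial (α.real B) p k * |g k|) :
    Integrable (fun η => g (η.meas.real B)) ρ := by
  have h : Integrable (fun k : ℕ => g k) (ρ.map (count B)) := by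
    rw [hρ.map_count hB]
    refine integrable_sum_dirac (fun k => ENNReal.ofReal_ne_top) ?_
    simpa [ENNReal.toReal_ofReal (negBinomial_nonneg measureReal_nonneg hp0 hp1 _)] using hs
  have h' := (integrable_map_measure h.aestronglyMeasurable
    (measurable_count hB).aemeasurable).1 h
  simpa [Function.comp_def, natCast_count hB] using h'

lemma IsPascal.integral_comp (hρ : IsPascal α p ρ) (hp0 : 0 < p) (hp1 : p < 1) {B : Set E}
    (hB : MeasurableSet B) (g : ℝ → ℝ) :
    ∫ η, g (η.meas.real B) ∂ρ = ∑' k : ℕ, negBinomial (α.real B) p k * g k := by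
  have h : ∫ k : ℕ, g k ∂(ρ.map (count B)) = ∑' k : ℕ, negBinomial (α.real B) p k * g k := by
    rw [hρ.map_count hB, integral_sum_dirac fun k => ENNReal.ofReal_ne_top]
    simp [ENNReal.toReal_ofReal (negBinomial_nonneg measureReal_nonneg hp0 hp1 _)]
  rw [← h, integral_map (measurable_count hB).aemeasurable
    (measurable_of_countable _).aestronglyMeasurable]
  simp [natCast_count hB]

end Law

/-! ### Functionals of polynomial growth -/

/-- Measurable functionals bounded by a power of the total mass. -/
def PolyGrowth (F : Conf E → ℝ) : Prop :=
  Measurable F ∧ ∃ C : ℝ, 0 ≤ C ∧ ∃ m : ℕ, ∀ η, |F η| ≤ C * (1 + η.meas.real Set.univ) ^ m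

namespace PolyGrowth

lemma const (c : ℝ) : PolyGrowth fun _ : Conf E => c :=
  ⟨measurable_const, |c|, abs_nonneg c, 0, fun _ => by simp⟩

lemma real {B : Set E} (hB : MeasurableSet B) : PolyGrowth fun η : Conf E => η.meas.real B := by
  refine ⟨measurable_real hB, 1, zero_le_one, 1, fun η => ?_⟩
  rw [abs_of_nonneg measureReal_nonneg, pow_one, one_mul]
  have := measureReal_mono (μ := η.meas) (Set.subset_univ B)
  linarith

lemma mul {F G : Conf E → ℝ} (hF : PolyGrowth F) (hG : PolyGrowth G) :
    PolyGrowth fun η => F η * G η := by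
  obtain ⟨hFm, C, hC, m, hF⟩ := hF
  obtain ⟨hGm, D, hD, l, hG⟩ := hG
  refine ⟨hFm.mul hGm, C * D, mul_nonneg hC hD, m + l, fun η => ?_⟩
  rw [abs_mul, pow_add]
  calc _ ≤ (C * (1 + η.meas.real Set.univ) ^ m) * (D * (1 + η.meas.real Set.univ) ^ l) :=
        mul_le_mul (hF η) (hG η) (abs_nonneg _) ((abs_nonneg _).trans (hF η))
    _ = _ := by ring

lemma add {F G : Conf E → ℝ} (hF : PolyGrowth F) (hG : PolyGrowth G) :
    PolyGrowth fun η => F η + G η := by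
  obtain ⟨hFm, C, hC, m, hF⟩ := hF
  obtain ⟨hGm, D, hD, l, hG⟩ := hG
  refine ⟨hFm.add hGm, C + D, add_nonneg hC hD, max m l, fun η => ?_⟩
  have h1 : 1 ≤ 1 + η.meas.real Set.univ := le_add_of_nonneg_right measureReal_nonneg
  rw [add_mul]
  refine (abs_add_le _ _).trans (add_le_add ((hF η).trans ?_) ((hG η).trans ?_))
  · exact mul_le_mul_of_nonneg_left (pow_le_pow_right₀ h1 (le_max_left m l)) hC
  · exact mul_le_mul_of_nonneg_left (pow_le_pow_right₀ h1 (le_max_right m l)) hD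

lemma sum {ι : Type*} (s : Finset ι) {F : ι → Conf E → ℝ} (hF : ∀ i ∈ s, PolyGrowth (F i)) :
    PolyGrowth fun η => ∑ i ∈ s, F i η := by
  classical
  induction s using Finset.induction_on with
  | empty => simpa using const 0
  | insert i s hi ih =>
    simp only [Finset.sum_insert hi]
    exact (hF i (Finset.mem_insert_self i s)).add
      (ih fun j hj => hF j (Finset.mem_insert_of_mem hj))

lemma prod {ι : Type*} (s : Finset ι) {F : ι → Conf E → ℝ} (hF : ∀ i ∈ s, PolyGrowth (F i)) :
    PolyGrowth fun η => ∏ i ∈ s, F i η := by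
  classical
  induction s using Finset.induction_on with
  | empty => simpa using const 1
  | insert i s hi ih =>
    simp only [Finset.prod_insert hi]
    exact (hF i (Finset.mem_insert_self i s)).mul
      (ih fun j hj => hF j (Finset.mem_insert_of_mem hj))

lemma pow {F : Conf E → ℝ} (hF : PolyGrowth F) (n : ℕ) : PolyGrowth fun η => F η ^ n := by
  simpa using prod (Finset.range n) (F := fun _ => F) fun _ _ => hF

lemma meixner (n : ℕ) (a p : ℝ) {B : Set E} (hB : MeasurableSet B) :
    PolyGrowth fun η : Conf E => PascalMeixner.meixner n (η.meas.real B) a p := by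
  obtain ⟨c, -, hc⟩ := exists_meixner_coeff n a p
  simp only [hc]
  exact sum _ fun j _ => (const (c j)).mul ((real hB).pow j)

variable {α : Measure E} {p : ℝ} {ρ : Measure (Conf E)}

/-- The total mass is itself negative binomial, so all its moments are finite. -/
lemma integrable {F : Conf E → ℝ} (hF : PolyGrowth F) (hρ : IsPascal α p ρ) (hp0 : 0 < p)
    (hp1 : p < 1) : Integrable F ρ := by
  obtain ⟨hFm, C, hC, m, hF⟩ := hF
  have h : Integrable (fun η : Conf E => (1 + η.meas.real Set.univ) ^ m) ρ := by
    refine hρ.integrable_comp hp0 hp1 MeasurableSet.univ (g := fun x => (1 + x) ^ m) ?_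
    have hs := summable_sum (s := Finset.range (m + 1)) fun j _ =>
      (summable_negBinomial_mul_pow (a := α.real Set.univ) measureReal_nonneg hp0 hp1 j).mul_left
        (m.choose j : ℝ)
    convert! hs using 2 with x
    rw [abs_of_nonneg (by positivity), add_comm, add_pow, Finset.mul_sum]
    exact Finset.sum_congr rfl fun j _ => by ring
  exact (h.const_mul C).mono' hFm.aestronglyMeasurable (.of_forall hF)

lemma memLp_two {F : Conf E → ℝ} (hF : PolyGrowth F) (hρ : IsPascal α p ρ) (hp0 : 0 < p)
    (hp1 : p < 1) : MemLp F 2 ρ :=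
  (memLp_two_iff_integrable_sq hF.1.aestronglyMeasurable).2 ((hF.pow 2).integrable hρ hp0 hp1)

end PolyGrowth

/-! ### Monomials -/

/-- On boxes the value is a product of counts, and boxes form a generating π-system. -/
lemma measurable_pi_meas (n : ℕ) :
    Measurable fun η : Conf E => Measure.pi fun _ : Fin n => η.meas := by
  refine Measurable.measure_of_isPiSystem generateFrom_pi.symm isPiSystem_pi ?_ ?_
  · rintro _ ⟨A, hA, rfl⟩
    simp only [Measure.pi_pi]
    exact Finset.measurable_fun_prod _ fun i _ => measurable_meas (hA i (Set.mem_univ i))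
  · simp only [Measure.pi_univ]
    exact Finset.measurable_fun_prod _ fun i _ => measurable_meas MeasurableSet.univ

section Monomial

variable {n : ℕ} {f : (Fin n → E) → ℝ} {C : ℝ}

lemma integrable_of_bounded (hf : Measurable f) (hC : ∀ x, |f x| ≤ C) (η : Conf E) :
    Integrable f (Measure.pi fun _ : Fin n => η.meas) :=
  .of_bound hf.aestronglyMeasurable C (.of_forall hC)

lemma polyGrowth_monomial (hf : Measurable f) (hC : ∀ x, |f x| ≤ C) :
    PolyGrowth (monomial f) := by
  refine ⟨?_, max C 0, le_max_right _ _, n, fun η => ?_⟩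
  · have h : monomial f = fun η : Conf E =>
        (∫⁻ x, ENNReal.ofReal (f x) ∂(Measure.pi fun _ : Fin n => η.meas)).toReal -
        (∫⁻ x, ENNReal.ofReal (-f x) ∂(Measure.pi fun _ : Fin n => η.meas)).toReal := by
      ext η
      exact integral_eq_lintegral_pos_part_sub_lintegral_neg_part (integrable_of_bounded hf hC η)
    rw [h]
    exact (((Measure.measurable_lintegral hf.ennreal_ofReal).comp
      (measurable_pi_meas n)).ennreal_toReal).sub
      (((Measure.measurable_lintegral hf.neg.ennreal_ofReal).comp
      (measurable_pi_meas n)).ennreal_toReal)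
  · have h := norm_integral_le_of_norm_le_const (μ := Measure.pi fun _ : Fin n => η.meas)
      (.of_forall fun x => (hC x).trans (le_max_left C 0) : ∀ᵐ x ∂_, ‖f x‖ ≤ max C 0)
    refine h.trans (mul_le_mul_of_nonneg_left ?_ (le_max_right _ _))
    rw [measureReal_def, Measure.pi_univ, ENNReal.toReal_prod, Finset.prod_const, Finset.card_univ,
      Fintype.card_fin]
    exact pow_le_pow_left₀ ENNReal.toReal_nonneg (by simp [measureReal_def]) n

lemma monomial_prod_indicator (A : Fin n → Set E) (hA : ∀ i, MeasurableSet (A i)) (η : Conf E) :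
    monomial (fun x => ∏ i, (A i).indicator (fun _ => (1 : ℝ)) (x i)) η =
      ∏ i, η.meas.real (A i) := by
  rw [monomial, integral_fintype_prod_eq_prod (fun i y => (A i).indicator (fun _ => (1 : ℝ)) y)]
  refine Finset.prod_congr rfl fun i _ => ?_
  exact integral_indicator_one (hA i)

lemma monomial_sub {g : (Fin n → E) → ℝ} {D : ℝ} (hf : Measurable f) (hC : ∀ x, |f x| ≤ C)
    (hg : Measurable g) (hD : ∀ x, |g x| ≤ D) (η : Conf E) :
    monomial (fun x => f x - g x) η = monomial f η - monomial g η :=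
  integral_sub (integrable_of_bounded hf hC η) (integrable_of_bounded hg hD η)

lemma lintegral_eq_ofReal_monomial (hf : Measurable f) (hC : ∀ x, |f x| ≤ C) (h0 : ∀ x, 0 ≤ f x)
    (η : Conf E) :
    ∫⁻ x, ENNReal.ofReal (f x) ∂(Measure.pi fun _ : Fin n => η.meas) =
      ENNReal.ofReal (monomial f η) :=
  (ofReal_integral_eq_lintegral_ofReal (integrable_of_bounded hf hC η) (.of_forall h0)).symm

end Monomial

/-! ### Reduction of orthogonality to boxes -/

section Orthogonality

variable {α : Measure E} {p : ℝ} {ρ : Measure (Conf E)}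

/-- The intensity measure on `E ^ n` of `η ^ n` weighted by the positive part of `Φ`. -/
def weightedIntensity (ρ : Measure (Conf E)) (Φ : Conf E → ℝ) (n : ℕ) : Measure (Fin n → E) :=
  (ρ.withDensity fun η => ENNReal.ofReal (Φ η)).bind fun η => Measure.pi fun _ => η.meas

lemma lintegral_weightedIntensity {Φ : Conf E → ℝ} (hΦ : Measurable Φ) {n : ℕ}
    {f : (Fin n → E) → ℝ} {C : ℝ} (hf : Measurable f) (hC : ∀ x, |f x| ≤ C)
    (h0 : ∀ x, 0 ≤ f x) :
    ∫⁻ x, ENNReal.ofReal (f x) ∂(weightedIntensity ρ Φ n) =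
      ∫⁻ η, ENNReal.ofReal (Φ η * monomial f η) ∂ρ := by
  rw [weightedIntensity, Measure.lintegral_bind (measurable_pi_meas n).aemeasurable
    hf.ennreal_ofReal.aemeasurable]
  simp only [lintegral_eq_ofReal_monomial hf hC h0]
  rw [lintegral_withDensity_eq_lintegral_mul _ hΦ.ennreal_ofReal
    (polyGrowth_monomial hf hC).1.ennreal_ofReal]
  refine lintegral_congr fun η => ?_
  rw [Pi.mul_apply, ENNReal.ofReal_mul' (show 0 ≤ monomial f η from integral_nonneg h0)]

lemma lintegral_weightedIntensity_ne_top {Φ : Conf E → ℝ} (hΦ : PolyGrowth Φ)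
    (hρ : IsPascal α p ρ) (hp0 : 0 < p) (hp1 : p < 1) {n : ℕ}
    {f : (Fin n → E) → ℝ} {C : ℝ} (hf : Measurable f) (hC : ∀ x, |f x| ≤ C)
    (h0 : ∀ x, 0 ≤ f x) :
    ∫⁻ x, ENNReal.ofReal (f x) ∂(weightedIntensity ρ Φ n) ≠ ⊤ := by
  rw [lintegral_weightedIntensity hΦ.1 hf hC h0]
  exact ((hΦ.mul (polyGrowth_monomial hf hC)).integrable hρ hp0 hp1).lintegral_lt_top.ne

/-- For `f ≥ 0` the monomial is nonnegative, so the positive and negative parts of the integrand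
come from those of `Φ`. -/
lemma integral_mul_monomial_eq_zero_iff {Φ : Conf E → ℝ} (hΦ : PolyGrowth Φ)
    (hρ : IsPascal α p ρ) (hp0 : 0 < p) (hp1 : p < 1) {n : ℕ}
    {f : (Fin n → E) → ℝ} {C : ℝ} (hf : Measurable f) (hC : ∀ x, |f x| ≤ C)
    (h0 : ∀ x, 0 ≤ f x) :
    ∫ η, Φ η * monomial f η ∂ρ = 0 ↔
      ∫⁻ x, ENNReal.ofReal (f x) ∂(weightedIntensity ρ Φ n) =
        ∫⁻ x, ENNReal.ofReal (f x) ∂(weightedIntensity ρ (fun η => -Φ η) n) := by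
  have hneg : PolyGrowth fun η => -Φ η := by
    simpa using (PolyGrowth.const (-1)).mul hΦ
  rw [← ENNReal.toReal_eq_toReal_iff'
    (lintegral_weightedIntensity_ne_top hΦ hρ hp0 hp1 hf hC h0)
    (lintegral_weightedIntensity_ne_top hneg hρ hp0 hp1 hf hC h0),
    lintegral_weightedIntensity hΦ.1 hf hC h0, lintegral_weightedIntensity hneg.1 hf hC h0,
    integral_eq_lintegral_pos_part_sub_lintegral_neg_part
      ((hΦ.mul (polyGrowth_monomial hf hC)).integrable hρ hp0 hp1), sub_eq_zero]
  simp only [neg_mul]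

/-- A functional orthogonal to all products of counts is orthogonal to all monomials. -/
lemma integral_mul_monomial_eq_zero {Φ : Conf E → ℝ} (hΦ : PolyGrowth Φ)
    (hρ : IsPascal α p ρ) (hp0 : 0 < p) (hp1 : p < 1) {n : ℕ}
    (hbox : ∀ A : Fin n → Set E, (∀ i, MeasurableSet (A i)) →
      ∫ η, Φ η * ∏ i, η.meas.real (A i) ∂ρ = 0)
    {f : (Fin n → E) → ℝ} {C : ℝ} (hf : Measurable f) (hC : ∀ x, |f x| ≤ C) :
    ∫ η, Φ η * monomial f η ∂ρ = 0 := by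
  have hset : ∀ A : Fin n → Set E, (∀ i, MeasurableSet (A i)) →
      weightedIntensity ρ Φ n (Set.univ.pi A) =
        weightedIntensity ρ (fun η => -Φ η) n (Set.univ.pi A) ∧
      weightedIntensity ρ Φ n (Set.univ.pi A) ≠ ⊤ := by
    intro A hA
    let g : (Fin n → E) → ℝ := fun x => ∏ i, (A i).indicator (fun _ => (1 : ℝ)) (x i)
    have hg : Measurable g := Finset.measurable_fun_prod _ fun i _ =>
      (measurable_const.indicator (hA i)).comp (measurable_pi_apply i)
    have hgi : (fun x => ENNReal.ofReal (g x)) = (Set.univ.pi A).indicator 1 := by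
      ext x
      by_cases hx : x ∈ Set.univ.pi A
      · have : g x = 1 := Finset.prod_eq_one fun i _ => by simp [hx i (Set.mem_univ i)]
        simp [hx, this]
      · obtain ⟨i, hi⟩ : ∃ i, x i ∉ A i := by simpa using hx
        have : g x = 0 := Finset.prod_eq_zero (Finset.mem_univ i) (by simp [hi])
        rw [this, Set.indicator_of_notMem hx, ENNReal.ofReal_zero]
    have h0 : ∀ x, 0 ≤ g x := fun x =>
      Finset.prod_nonneg fun i _ => Set.indicator_nonneg (fun _ _ => zero_le_one) _
    have h1 : ∀ x, |g x| ≤ 1 := fun x => by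
      rw [abs_of_nonneg (h0 x)]
      exact Finset.prod_le_one (fun i _ => Set.indicator_nonneg (fun _ _ => zero_le_one) _)
        fun i _ => Set.indicator_le_self' (fun _ _ => zero_le_one) _
    have hm : MeasurableSet (Set.univ.pi A) := MeasurableSet.univ_pi hA
    have h := integral_mul_monomial_eq_zero_iff hΦ hρ hp0 hp1 hg h1 h0
    have hfin := lintegral_weightedIntensity_ne_top hΦ hρ hp0 hp1 hg h1 h0
    simp only [g, monomial_prod_indicator A hA] at h
    rw [hgi, lintegral_indicator_one hm] at hfin
    refine ⟨?_, hfin⟩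
    have h' := h.1 (hbox A hA)
    rwa [hgi, lintegral_indicator_one hm, lintegral_indicator_one hm] at h'
  have huniv := hset (fun _ => Set.univ) fun _ => MeasurableSet.univ
  rw [Set.pi_univ] at huniv
  have : IsFiniteMeasure (weightedIntensity ρ Φ n) := ⟨huniv.2.lt_top⟩
  have heq : weightedIntensity ρ Φ n = weightedIntensity ρ (fun η => -Φ η) n := by
    refine ext_of_generate_finite _ generateFrom_pi.symm isPiSystem_pi ?_ huniv.1
    rintro _ ⟨A, hA, rfl⟩
    exact (hset A fun i => hA i (Set.mem_univ i)).1
  have hpos : ∀ {g : (Fin n → E) → ℝ} {D : ℝ}, Measurable g → (∀ x, |g x| ≤ D) →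
      (∀ x, 0 ≤ g x) → ∫ η, Φ η * monomial g η ∂ρ = 0 := fun hg hD h0 =>
    (integral_mul_monomial_eq_zero_iff hΦ hρ hp0 hp1 hg hD h0).2 (by rw [← heq])
  -- A signed `f` is the difference of the bounded nonnegative functions |f| and |f| - f.
  have hC' : ∀ x, |(|f x|)| ≤ C := fun x => by simpa using hC x
  have hsub : ∀ x, |(|f x| - f x)| ≤ 2 * C := fun x => by
    have := hC x
    have := abs_sub (|f x|) (f x)
    simp only [abs_abs] at this
    linarith
  have hms : Measurable fun x => |f x| - f x := hf.abs.sub hf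
  have hmon : ∀ η, Φ η * monomial f η = Φ η * monomial (fun x => |f x|) η -
      Φ η * monomial (fun x => |f x| - f x) η := fun η => by
    rw [monomial_sub hf.abs hC' hf hC]
    ring
  simp only [hmon]
  rw [integral_sub ((hΦ.mul (polyGrowth_monomial hf.abs hC')).integrable hρ hp0 hp1)
    ((hΦ.mul (polyGrowth_monomial hms hsub)).integrable hρ hp0 hp1),
    hpos hf.abs hC' fun x => abs_nonneg _,
    hpos hms hsub fun x => sub_nonneg.2 (le_abs_self _), sub_zero]

end Orthogonality

end

section

variable {E : Type*}

/-! ### Tensor products of indicators -/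

lemma tensorIndicator_eq_prod {N : ℕ} (d : Fin N → ℕ) (B : Fin N → Set E) (x : Fin (∑ k, d k) → E) :
    tensorIndicator B d x =
      ∏ i, (B (finSigmaFinEquiv.symm i).1).indicator (fun _ => (1 : ℝ)) (x i) := by
  rw [← Equiv.prod_comp finSigmaFinEquiv, Fintype.prod_sigma]
  simp [tensorIndicator]

lemma abs_tensorIndicator_le_one {N : ℕ} {B : Fin N → Set E} (d : Fin N → ℕ)
    (x : Fin (∑ k, d k) → E) : |tensorIndicator B d x| ≤ 1 := by
  rw [tensorIndicator_eq_prod, Finset.abs_prod]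
  refine Finset.prod_le_one (fun i _ => abs_nonneg _) fun i _ => ?_
  by_cases h : x i ∈ B (finSigmaFinEquiv.symm i).1 <;> simp [h]

/-! ### Orthogonality of products of Meixner polynomials -/

section Atoms

variable {ι : Type*} {k : ℕ} (B : ι → Set E) (A : Fin k → Set E)

/-- The part of `B i` whose points lie in exactly those `A j` with `j ∈ u`. -/
def atom (t : ι × Finset (Fin k)) : Set E := B t.1 ∩ {x | ∀ j, x ∈ A j ↔ j ∈ t.2}

variable {B A}

lemma pairwise_disjoint_atom (hdisj : Pairwise (Function.onFun Disjoint B)) :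
    Pairwise (Function.onFun Disjoint (atom B A)) := by
  rintro ⟨i, u⟩ ⟨j, v⟩ h
  rw [Function.onFun, Set.disjoint_left]
  rintro x ⟨hx, hxu⟩ ⟨hx', hxu'⟩
  refine h (Prod.ext ?_ ?_)
  · by_contra hi
    exact Set.disjoint_left.1 (hdisj hi) hx hx'
  · ext j
    exact (hxu j).symm.trans (hxu' j)

variable [MeasurableSpace E]

lemma measurableSet_atom (hB : ∀ i, MeasurableSet (B i)) (hA : ∀ j, MeasurableSet (A j))
    (t : ι × Finset (Fin k)) : MeasurableSet (atom B A t) := by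
  refine (hB t.1).inter ?_
  rw [Set.ofPred_forall]
  refine MeasurableSet.iInter fun j => ?_
  by_cases hj : j ∈ t.2
  · simpa [hj] using hA j
  · simp only [hj, iff_false]
    exact (hA j).compl

variable (μ : Measure E) [IsFiniteMeasure μ]

lemma measureReal_eq_sum_atom (hB : ∀ i, MeasurableSet (B i)) (hA : ∀ j, MeasurableSet (A j))
    (hdisj : Pairwise (Function.onFun Disjoint B)) (i : ι) :
    μ.real (B i) = ∑ u, μ.real (atom B A (i, u)) := by
  classical
  rw [← measureReal_biUnion_finset]
  · congr 1
    ext x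
    simp only [Finset.mem_univ, Set.iUnion_true, Set.mem_iUnion, atom]
    refine ⟨fun hx => ⟨Finset.univ.filter fun j => x ∈ A j, hx, by simp⟩, fun ⟨u, hx, _⟩ => hx⟩
  · exact fun u _ v _ huv => pairwise_disjoint_atom hdisj (by simpa using huv)
  · exact fun u _ => measurableSet_atom hB hA _

lemma measureReal_eq_sum_filter_atom [Fintype ι] (hB : ∀ i, MeasurableSet (B i))
    (hA : ∀ j, MeasurableSet (A j)) (hdisj : Pairwise (Function.onFun Disjoint B))
    (hcover : ∀ x, ∃ i, x ∈ B i) (j : Fin k) :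
    μ.real (A j) =
      ∑ t ∈ (Finset.univ : Finset (ι × Finset (Fin k))).filter (fun t => j ∈ t.2),
        μ.real (atom B A t) := by
  classical
  rw [← measureReal_biUnion_finset]
  · congr 1
    ext x
    simp only [Finset.mem_filter, Finset.mem_univ, true_and, Set.mem_iUnion, exists_prop]
    constructor
    · intro hx
      obtain ⟨i, hi⟩ := hcover x
      exact ⟨(i, Finset.univ.filter fun j => x ∈ A j), by simpa using hx, hi, by simp⟩
    · rintro ⟨t, ht, -, hx⟩
      exact (hx j).2 ht
  · exact fun s _ t _ hst => pairwise_disjoint_atom hdisj hst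
  · exact fun t _ => measurableSet_atom hB hA t

end Atoms

variable [MeasurableSpace E]

section Product

variable {α : Measure E} {p : ℝ} {ρ : Measure (Conf E)}

lemma IsPascal.iIndepFun_meas (hρ : IsPascal α p ρ) {T : Type*} [Fintype T] {C : T → Set E}
    (hC : ∀ t, MeasurableSet (C t)) (hdisj : Pairwise (Function.onFun Disjoint C)) :
    iIndepFun (fun t (η : Conf E) => η.meas (C t)) ρ := by
  let e := Fintype.equivFin T
  have h := hρ.indep (Fintype.card T) (fun i => C (e.symm i)) (fun i => hC _)
    fun i j hij => hdisj (e.symm.injective.ne hij)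
  simpa using h.precomp e.injective

lemma IsPascal.integral_pow_mul_meixner (hρ : IsPascal α p ρ) (hp0 : 0 < p) (hp1 : p < 1)
    {B : Set E} (hB : MeasurableSet B) {n j : ℕ} (hj : j < n) :
    ∫ η, η.meas.real B ^ j * meixner n (η.meas.real B) (α.real B) p ∂ρ = 0 := by
  rw [hρ.integral_comp hp0 hp1 hB fun x => x ^ j * meixner n x (α.real B) p]
  exact (hasSum_negBinomial_mul_pow_mul_meixner _ hp0 hp1 hj).tsum_eq

/-- On disjoint sets, a product of counts is orthogonal to a product of Meixner polynomials of
larger total degree. -/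
lemma IsPascal.integral_prod_comp_mul_prod_meixner (hρ : IsPascal α p ρ) (hp0 : 0 < p)
    (hp1 : p < 1) {T : Type*} [Fintype T] {C : T → Set E}
    (hC : ∀ t, MeasurableSet (C t)) (hdisj : Pairwise (Function.onFun Disjoint C))
    {k : ℕ} (φ : Fin k → T) (e : T → ℕ) (hk : k < ∑ t, e t) :
    ∫ η, (∏ j, η.meas.real (C (φ j))) *
      ∏ t, meixner (e t) (η.meas.real (C t)) (α.real (C t)) p ∂ρ = 0 := by
  classical
  let m : T → ℕ := fun t => (Finset.univ.filter fun j => φ j = t).card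
  have hm : ∑ t, m t = k := by
    rw [← Finset.card_eq_sum_card_fiberwise (s := Finset.univ) (f := φ) (by simp)]
    simp
  have hprod : ∀ η : Conf E, ∏ j, η.meas.real (C (φ j)) = ∏ t, η.meas.real (C t) ^ m t := by
    intro η
    rw [← Finset.prod_fiberwise_of_maps_to' (s := Finset.univ) (t := Finset.univ) (g := φ)
      (by simp) fun t => η.meas.real (C t)]
    simp [m]
  -- The exponents `m t` sum to `k`, which is less than the sum of the `e t`; at some `t` the
  -- exponent is therefore below the Meixner degree.
  obtain ⟨t, -, ht⟩ := Finset.exists_lt_of_sum_lt (hm.trans_lt hk)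
  simp only [hprod, ← Finset.prod_mul_distrib]
  have h := (hρ.iIndepFun_meas hC hdisj).integral_fun_prod_comp
    (f := fun t x => x.toReal ^ m t * meixner (e t) x.toReal (α.real (C t)) p)
    (fun t => (measurable_meas (hC t)).aemeasurable)
    (fun t => ((ENNReal.measurable_toReal.pow_const _).mul
      ((measurable_meixner _ _ _).comp ENNReal.measurable_toReal)).aestronglyMeasurable)
  exact h.trans (Finset.prod_eq_zero (Finset.mem_univ t)
    (hρ.integral_pow_mul_meixner hp0 hp1 (hC t) ht))

/-- The addition theorem applies because counts take values in ℕ; the counts and the values of `α`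
add up over the same atoms. -/
lemma meixner_eq_sum_atom [IsFiniteMeasure α] {ι : Type*} [Fintype ι] {k : ℕ} {B : ι → Set E}
    {A : Fin k → Set E} (hB : ∀ i, MeasurableSet (B i)) (hA : ∀ j, MeasurableSet (A j))
    (hdisj : Pairwise (Function.onFun Disjoint B)) (n : ℕ) (p : ℝ) (i : ι) (η : Conf E) :
    meixner n (η.meas.real (B i)) (α.real (B i)) p = n.factorial *
      ∑ l ∈ (Finset.univ : Finset (Finset (Fin k))).finsuppAntidiag n,
        ∏ u, (meixner (l u) (η.meas.real (atom B A (i, u))) (α.real (atom B A (i, u))) p /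
          (l u).factorial) := by
  have h := meixner_sum Finset.univ n p (fun u => α.real (atom B A (i, u)))
    (fun u => count (atom B A (i, u)) η)
  simp only [Nat.cast_sum, natCast_count (measurableSet_atom hB hA _)] at h
  rwa [← measureReal_eq_sum_atom η.meas hB hA hdisj, ← measureReal_eq_sum_atom α hB hA hdisj] at h

lemma IsPascal.integral_prod_meixner_mul_prod_of_cover [IsFiniteMeasure α] (hρ : IsPascal α p ρ)
    (hp0 : 0 < p) (hp1 : p < 1) {ι : Type*} [Fintype ι] {B : ι → Set E}
    (hB : ∀ i, MeasurableSet (B i)) (hdisj : Pairwise (Function.onFun Disjoint B))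
    (hcover : ∀ x, ∃ i, x ∈ B i) (d : ι → ℕ) {k : ℕ} (hk : k < ∑ i, d i)
    {A : Fin k → Set E} (hA : ∀ j, MeasurableSet (A j)) :
    ∫ η, (∏ i, meixner (d i) (η.meas.real (B i)) (α.real (B i)) p) *
      ∏ j, η.meas.real (A j) ∂ρ = 0 := by
  classical
  -- In the expansion, `φ` selects one atom inside each `A j`, and `l i` distributes the degree `d
  -- i` over the atoms of `B i`.
  let T := ι × Finset (Fin k)
  let S : Finset (Fin k → T) :=
    Fintype.piFinset fun j => (Finset.univ : Finset T).filter fun t => j ∈ t.2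
  let L : Finset (ι → Finset (Fin k) →₀ ℕ) :=
    Fintype.piFinset fun i => (Finset.univ : Finset (Finset (Fin k))).finsuppAntidiag (d i)
  let F : (ι → Finset (Fin k) →₀ ℕ) → (Fin k → T) → Conf E → ℝ := fun l φ η =>
    (∏ j, η.meas.real (atom B A (φ j))) *
      ∏ t : T, meixner (l t.1 t.2) (η.meas.real (atom B A t)) (α.real (atom B A t)) p
  let c : (ι → Finset (Fin k) →₀ ℕ) → ℝ := fun l =>
    (∏ i, ((d i).factorial : ℝ)) * (∏ t : T, ((l t.1 t.2).factorial : ℝ))⁻¹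
  have hC := measurableSet_atom hB hA
  have hexpand : ∀ η : Conf E, (∏ i, meixner (d i) (η.meas.real (B i)) (α.real (B i)) p) *
      ∏ j, η.meas.real (A j) = ∑ l ∈ L, ∑ φ ∈ S, c l * F l φ η := by
    intro η
    simp only [meixner_eq_sum_atom hB hA hdisj,
      measureReal_eq_sum_filter_atom η.meas hB hA hdisj hcover]
    rw [Finset.prod_mul_distrib, Finset.prod_univ_sum, Finset.prod_univ_sum, mul_assoc,
      Finset.sum_mul_sum, Finset.mul_sum]
    refine Finset.sum_congr rfl fun l _ => ?_
    rw [Finset.mul_sum]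
    refine Finset.sum_congr rfl fun φ _ => ?_
    simp only [c, F, T, Fintype.prod_prod_type, Finset.prod_div_distrib]
    ring
  have hF_int : ∀ l φ, Integrable (fun η => c l * F l φ η) ρ := fun l φ =>
    ((PolyGrowth.const _).mul ((PolyGrowth.prod _ fun j _ => .real (hC _)).mul
      (PolyGrowth.prod _ fun t _ => .meixner _ _ _ (hC t)))).integrable hρ hp0 hp1
  simp only [hexpand]
  rw [integral_finsetSum _ fun l _ => integrable_finsetSum _ fun φ _ => hF_int l φ]
  refine Finset.sum_eq_zero fun l hl => ?_
  rw [integral_finsetSum _ fun φ _ => hF_int l φ]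
  refine Finset.sum_eq_zero fun φ _ => ?_
  rw [integral_const_mul]
  refine mul_eq_zero_of_right _ (hρ.integral_prod_comp_mul_prod_meixner hp0 hp1 hC
    (pairwise_disjoint_atom hdisj) φ (fun t => l t.1 t.2) (hk.trans_eq ?_))
  rw [Fintype.sum_prod_type]
  refine Finset.sum_congr rfl fun i _ => ?_
  exact (Finset.mem_finsuppAntidiag.1 (Fintype.mem_piFinset.1 hl i)).1.symm

/-- Products of Meixner polynomials in disjoint counts are orthogonal to products of fewer
counts. -/
lemma IsPascal.integral_prod_meixner_mul_prod [IsFiniteMeasure α] (hρ : IsPascal α p ρ)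
    (hp0 : 0 < p) (hp1 : p < 1) {ι : Type*} [Fintype ι] {B : ι → Set E}
    (hB : ∀ i, MeasurableSet (B i)) (hdisj : Pairwise (Function.onFun Disjoint B))
    (d : ι → ℕ) {k : ℕ} (hk : k < ∑ i, d i)
    {A : Fin k → Set E} (hA : ∀ j, MeasurableSet (A j)) :
    ∫ η, (∏ i, meixner (d i) (η.meas.real (B i)) (α.real (B i)) p) *
      ∏ j, η.meas.real (A j) ∂ρ = 0 := by
  -- Adding the complement of the union with degree 0 produces a cover and changes nothing else, as
  -- the Meixner polynomial of degree 0 is 1.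
  let B' : Option ι → Set E := fun o => o.elim (⋃ i, B i)ᶜ B
  let d' : Option ι → ℕ := fun o => o.elim 0 d
  have h := hρ.integral_prod_meixner_mul_prod_of_cover hp0 hp1 (B := B') (d := d') ?_ ?_ ?_
    (k := k) ?_ hA
  · simpa [Fintype.prod_option, B', d', meixner] using h
  · rintro (_ | i)
    · exact (MeasurableSet.iUnion hB).compl
    · exact hB i
  · rintro (_ | i) (_ | j) hij
    · exact absurd rfl hij
    · exact (Set.disjoint_compl_left_iff_subset.2 (Set.subset_iUnion B j))
    · exact (Set.disjoint_compl_right_iff_subset.2 (Set.subset_iUnion B i))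
    · exact hdisj fun h => hij (congrArg some h)
  · intro x
    by_cases hx : ∃ i, x ∈ B i
    · obtain ⟨i, hi⟩ := hx
      exact ⟨some i, hi⟩
    · exact ⟨none, by simpa [B'] using hx⟩
  · simpa [Fintype.sum_option, d'] using hk

end Product

/-! ### Leading terms of products of Meixner polynomials -/

section Tensor

variable {N : ℕ} {B : Fin N → Set E} (d : Fin N → ℕ)

lemma monomial_tensorIndicator (hB : ∀ k, MeasurableSet (B k)) (η : Conf E) :
    monomial (tensorIndicator B d) η = ∏ k, η.meas.real (B k) ^ d k := by
  rw [funext (tensorIndicator_eq_prod d B), monomial_prod_indicator _ fun i => hB _,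
    ← Equiv.prod_comp finSigmaFinEquiv, Fintype.prod_sigma]
  simp

lemma measurable_tensorIndicator (hB : ∀ k, MeasurableSet (B k)) :
    Measurable (tensorIndicator B d) := by
  rw [funext (tensorIndicator_eq_prod d B)]
  exact Finset.measurable_fun_prod _ fun i _ =>
    (measurable_const.indicator (hB _)).comp (measurable_pi_apply i)

/-- A product of Meixner polynomials has the monomial with the same degrees as leading term. -/
lemma monomial_sub_prod_meixner_mem_polyDegLT (hB : ∀ k, MeasurableSet (B k)) (a : Fin N → ℝ)
    (p : ℝ) :
    (fun η : Conf E => monomial (tensorIndicator B d) η -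
      ∏ k, meixner (d k) (η.meas.real (B k)) (a k) p) ∈ polyDegLT E (∑ k, d k) := by
  classical
  choose c hc1 hc using fun k => exists_meixner_coeff (d k) (a k) p
  -- `S` consists of the multi-indices `e ≤ d`. The term `e = d` has coefficient 1 and cancels the
  -- monomial; every other `e` has strictly smaller total degree.
  let S : Finset (Fin N → ℕ) := Fintype.piFinset fun k => Finset.range (d k + 1)
  have hd : d ∈ S := by simp [S]
  have h : (fun η : Conf E => monomial (tensorIndicator B d) η -
      ∏ k, meixner (d k) (η.meas.real (B k)) (a k) p) =
      ∑ e ∈ S.erase d, (-∏ k, c k (e k)) • (monomial (tensorIndicator B e) : Conf E → ℝ) := by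
    ext η
    simp only [hc, Finset.prod_univ_sum]
    rw [← Finset.add_sum_erase _ _ hd, Finset.sum_apply]
    simp only [Pi.smul_apply, monomial_tensorIndicator _ hB, Finset.prod_mul_distrib, hc1, S,
      smul_eq_mul, neg_mul, Finset.sum_neg_distrib, one_mul]
    ring
  rw [h]
  refine Submodule.sum_mem _ fun e he => Submodule.smul_mem _ _ (Submodule.subset_span ?_)
  obtain ⟨hne, heS⟩ := Finset.mem_erase.1 he
  have hle : e ≤ d := fun k =>
    Nat.lt_succ_iff.1 (Finset.mem_range.1 (Fintype.mem_piFinset.1 heS k))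
  exact ⟨∑ k, e k, Fintype.sum_strictMono (lt_of_le_of_ne hle hne), tensorIndicator B e,
    measurable_tensorIndicator e hB, ⟨1, abs_tensorIndicator_le_one e⟩, rfl⟩

end Tensor

/-- Growth of `q` is carried through the induction on the span because splitting the integral of a
sum needs integrability. -/
lemma PolyGrowth.integral_mul_eq_zero_of_mem_polyDegLT {α : Measure E} {p : ℝ}
    {ρ : Measure (Conf E)} {Φ : Conf E → ℝ} (hΦ : PolyGrowth Φ) (hρ : IsPascal α p ρ)
    (hp0 : 0 < p) (hp1 : p < 1) {n : ℕ}
    (hbox : ∀ k < n, ∀ A : Fin k → Set E, (∀ i, MeasurableSet (A i)) →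
      ∫ η, Φ η * ∏ i, η.meas.real (A i) ∂ρ = 0)
    {q : Conf E → ℝ} (hq : q ∈ polyDegLT E n) :
    PolyGrowth q ∧ ∫ η, Φ η * q η ∂ρ = 0 := by
  induction hq using Submodule.span_induction with
  | mem q hq =>
    obtain ⟨k, hk, f, hf, ⟨C, hC⟩, rfl⟩ := hq
    exact ⟨polyGrowth_monomial hf hC,
      integral_mul_monomial_eq_zero hΦ hρ hp0 hp1 (hbox k hk) hf hC⟩
  | zero => exact ⟨PolyGrowth.const 0, by simp⟩
  | add q r _ _ hq hr =>
    refine ⟨hq.1.add hr.1, ?_⟩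
    simp only [Pi.add_apply, mul_add]
    rw [integral_add ((hΦ.mul hq.1).integrable hρ hp0 hp1)
      ((hΦ.mul hr.1).integrable hρ hp0 hp1), hq.2, hr.2, add_zero]
  | smul c q _ hq =>
    refine ⟨(PolyGrowth.const c).mul hq.1, ?_⟩
    simp only [Pi.smul_apply, smul_eq_mul, mul_left_comm _ c]
    rw [integral_const_mul, hq.2, mul_zero]

end

end PascalMeixner

end

open PascalMeixner in
theorem mainTheorem4 {E : Type*} [MeasurableSpace E] [StandardBorelSpace E]
    (α : Measure E) [IsFiniteMeasure α] (p : ℝ) (hp0 : 0 < p) (hp1 : p < 1)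
    (ρ : Measure (PascalMeixner.Conf E)) [IsProbabilityMeasure ρ]
    (hρ : PascalMeixner.IsPascal α p ρ)
    (N : ℕ) (B : Fin N → Set E) (hB : ∀ k, MeasurableSet (B k))
    (hdisj : Pairwise (Function.onFun Disjoint B)) (d : Fin N → ℕ) :
    ∃ h : MemLp (PascalMeixner.monomial (PascalMeixner.tensorIndicator B d)) 2 ρ,
      ∀ᵐ η ∂ρ, PascalMeixner.genOrthPoly ρ (PascalMeixner.tensorIndicator B d) h η =
        ∏ k, PascalMeixner.meixner (d k) (η.meas.real (B k)) (α.real (B k)) p := by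
  let Φ : Conf E → ℝ := fun η => ∏ k, meixner (d k) (η.meas.real (B k)) (α.real (B k)) p
  have hΦ : PolyGrowth Φ := PolyGrowth.prod _ fun k _ => .meixner _ _ _ (hB k)
  have hΦ2 : MemLp Φ 2 ρ := hΦ.memLp_two hρ hp0 hp1
  have h2 : MemLp (monomial (tensorIndicator B d)) 2 ρ :=
    (polyGrowth_monomial (measurable_tensorIndicator d hB)
      (abs_tensorIndicator_le_one d)).memLp_two hρ hp0 hp1
  refine ⟨h2, ?_⟩
  have horth : hΦ2.toLp Φ ∈ ((polyL2 ρ (∑ k, d k)).topologicalClosure)ᗮ := by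
    rw [Submodule.orthogonal_closure, Submodule.mem_orthogonal']
    rintro G ⟨q, hq, hGq⟩
    rw [L2.inner_def, ← (hΦ.integral_mul_eq_zero_of_mem_polyDegLT hρ hp0 hp1
      (fun k hk A hA => hρ.integral_prod_meixner_mul_prod hp0 hp1 hB hdisj d hk hA) hq).2]
    refine integral_congr_ae ?_
    filter_upwards [hGq, hΦ2.coeFn_toLp] with η h1 h2
    rw [h1, h2]
    simp [mul_comm]
  -- The projection onto a closed subspace is characterized by membership and an orthogonal
  -- remainder. Here the subspace is itself an orthogonal complement, so the remainder must lie in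
  -- the double complement.
  have hsub : h2.toLp _ - hΦ2.toLp Φ ∈ ((polyL2 ρ (∑ k, d k)).topologicalClosure)ᗮᗮ := by
    refine Submodule.le_orthogonal_orthogonal _ (Submodule.le_topologicalClosure _
      ⟨_, monomial_sub_prod_meixner_mem_polyDegLT d hB (fun k => α.real (B k)) p, ?_⟩)
    rw [← MemLp.toLp_sub]
    exact MemLp.coeFn_toLp _
  have hproj : genOrthPoly ρ (tensorIndicator B d) h2 = hΦ2.toLp Φ :=
    Submodule.eq_starProjection_of_mem_orthogonal horth hsub
  rw [hproj]
  exact hΦ2.coeFn_toLp
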